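/- **Setting.** Let $m,n,T$ be natural numbers, $M\in\mathbb R^{m\times m}$ and $N\in\mathbb R^{n\times n}$ symmetric positive definite (the side information), $\gamma>0$ and $\widehat{\mathcal D}\ge 1$. Put $\mathcal R_M=\max_i (M^{-1})_{ii}$, $\mathcal R_N=\max_j (N^{-1})_{jj}$, and for $P\in\mathbb R^{m\times d}$, $Q\in\mathbb R^{n\times d}$ put $\Delta(P,Q)=\mathcal R_M\operatorname{Tr}(P^{T}MP)+\mathcal R_N\operatorname{Tr}(Q^{T}NQ)$. For a matrix $A$ with nonzero rows, $\bar A$ denotes $A$ with each row divided by its Euclidean norm. The quasi-dimension of $U\in\mathbb R^{m\times n}$ is $$\mathcal D^{\gamma}_{M,N}(U)=\min\{\Delta(P,Q): PQ^{T}=\gamma U,\ \text{all rows of } P \text{ and } Q \text{ have Euclidean norm } 1\}$$ (over all inner dimensions $d$). Assume that $\widehat{\mathcal D}\ge\mathcal D^{\gamma}_{M,N}(U)$ for some $U\in\mathbb R^{m\times n}$ for which such a factorisation exists. Let $\mathcal X=\{\bar P\bar Q^{T}:\Delta(\bar P,\bar Q)\le\widehat{\mathcal D}\}$, let $h_\gamma(x)=0$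 if $x\ge\gamma$ and $h_\gamma(x)=1-x/\gamma$ otherwise, and for a sequence $\mathcal S=((i_t,j_t),y_t)_{t=1}^{T}$ in $([m]\times[n])\times\{-1,1\}$ let $$\mathrm{hloss}(\mathcal S,\gamma)=\min_{\bar P\bar Q^{T}\in\mathcal X}\ \sum_{t=1}^{T}h_\gamma\!\left(\frac{y_t\,P_{i_t}Q_{j_t}^{T}}{\|P_{i_t}\|_2\|Q_{j_t}\|_2}\right).$$ **Algorithm** (parameter $\eta>0$). Let $E$ be the identity matrix, $A\bullet B=\sum_{k,l}A_{kl}B_{kl}$, $\Gamma=\begin{pmatrix}\sqrt{\mathcal R_M}\sqrt M&0\\0&\sqrt{\mathcal R_N}\sqrt N\end{pmatrix}$ and $$\mathcal K=\{W\in\mathbb R^{(m+n)\times(m+n)}: W \text{ symmetric positive semidefinite},\ W_{kk}\le 1\ \forall k,\ \operatorname{Tr}(\Gamma W\Gamma)\le\widehat{\mathcal D}\}.$$ Start with an arbitrary $W_1\in\mathcal K$. In round $t=1,\dots,T$: receive $(i_t,j_t)$; let $Z_t=\frac12(e_{i_t}e_{m+j_t}^{T}+e_{m+j_t}e_{i_t}^{T})$;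 predict $\hat y_t=\operatorname{sgn}(W_t\bullet Z_t)\in\{-1,1\}$ (either value if $W_t\bullet Z_t=0$); receive $y_t$. If $\hat y_t\ne y_t$, let $L_t=-\frac{y_t}{\gamma}Z_t$ and $$W_{t+1}=\operatorname*{arg\,min}_{W\in\mathcal K}\ \Bigl(-\ln\det(\Gamma W\Gamma+E)+\eta\sum_{s=1}^{t}W\bullet L_s\Bigr);$$ otherwise let $L_t=0$ and $W_{t+1}=W_t$. **Theorem.** There is a universal constant $c_0>0$ such that for every $c\in(0,c_0]$ there is a constant $C>0$ depending only on $c$ with the following property. For all $m,n,T,M,N,\gamma,\widehat{\mathcal D}$ and $\mathcal S$ as above, the algorithm with $\eta=c\gamma^2$ is well defined (from every $W_1\in\mathcal K$ it has a run on $\mathcal S$), and every run makes a number of mistakes $$\sum_{t=1}^{T}\mathbb I_{\hat y_t\ne y_t}\ \le\ C\,\frac{\widehat{\mathcal D}}{\gamma^{2}}+2\,\mathrm{hloss}(\mathcal S,\gamma).$$ In particular there is no factor $\log(m+n)$. -/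

import Mathlib

open scoped Matrix

noncomputable section

namespace OMC

/-- The hinge loss `h_γ`. -/
def hinge (γ x : ℝ) : ℝ := if γ ≤ x then 0 else 1 - x / γ

/-- Euclidean norm of the `i`-th row. -/
def rowNorm {k l : ℕ} (A : Matrix (Fin k) (Fin l) ℝ) (i : Fin k) : ℝ :=
  √(∑ j, A i j ^ 2)

/-- The class of row-normalised matrices: every row has Euclidean norm `1`. -/
def rowNormalized (k l : ℕ) : Set (Matrix (Fin k) (Fin l) ℝ) :=
  {A | ∀ i, rowNorm A i = 1}

/-- All rows are nonzero, so that the rows can be normalised. -/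
def NonzeroRows {k l : ℕ} (A : Matrix (Fin k) (Fin l) ℝ) : Prop :=
  ∀ i, A i ≠ 0

/-- `Ā`, obtained from `A` by dividing every row by its Euclidean norm. -/
def normalizeRows {k l : ℕ} (A : Matrix (Fin k) (Fin l) ℝ) : Matrix (Fin k) (Fin l) ℝ :=
  Matrix.diagonal (fun i => 1 / rowNorm A i) * A

/-- Squared radius `R_M = max_i (M⁺)_{ii}`. It is only used for positive definite `M`, where the
pseudo-inverse is the inverse. -/
def sqRadius {k : ℕ} (M : Matrix (Fin k) (Fin k) ℝ) : ℝ := ⨆ i, M⁻¹ i i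

/-- `R_M Tr(Pᵀ M P) + R_N Tr(Qᵀ N Q)`. -/
def sideComplexity {m n d : ℕ} (M : Matrix (Fin m) (Fin m) ℝ) (N : Matrix (Fin n) (Fin n) ℝ)
    (P : Matrix (Fin m) (Fin d) ℝ) (Q : Matrix (Fin n) (Fin d) ℝ) : ℝ :=
  sqRadius M * (Pᵀ * M * P).trace + sqRadius N * (Qᵀ * N * Q).trace

/-- The values over which the quasi-dimension of `U` at margin `γ` is the minimum: one for each
factorisation `P Qᵀ = γ U` with row-normalised `P`, `Q` (of any inner dimension `d`). -/
def quasiDimValues {m n : ℕ} (M : Matrix (Fin m) (Fin m) ℝ) (N : Matrix (Fin n) (Fin n) ℝ)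
    (γ : ℝ) (U : Matrix (Fin m) (Fin n) ℝ) : Set ℝ :=
  {v | ∃ (d : ℕ) (P : Matrix (Fin m) (Fin d) ℝ) (Q : Matrix (Fin n) (Fin d) ℝ),
    P ∈ rowNormalized m d ∧ Q ∈ rowNormalized n d ∧ P * Qᵀ = γ • U ∧
      v = sideComplexity M N P Q}

/-- The quasi-dimension of `U` with respect to the side information `M`, `N` at margin `γ`
(meaningful when `quasiDimValues M N γ U` is nonempty, i.e. when the max norm of `U` is at most
`1 / γ`). -/
def quasiDim {m n : ℕ} (M : Matrix (Fin m) (Fin m) ℝ) (N : Matrix (Fin n) (Fin n) ℝ)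
    (γ : ℝ) (U : Matrix (Fin m) (Fin n) ℝ) : ℝ :=
  sInf (quasiDimValues M N γ U)

/-- The competitor class `𝒳`. -/
def competitors {m n : ℕ} (M : Matrix (Fin m) (Fin m) ℝ) (N : Matrix (Fin n) (Fin n) ℝ)
    (D : ℝ) : Set (Matrix (Fin m) (Fin n) ℝ) :=
  {X | ∃ (d : ℕ) (P : Matrix (Fin m) (Fin d) ℝ) (Q : Matrix (Fin n) (Fin d) ℝ),
    NonzeroRows P ∧ NonzeroRows Q ∧
      sideComplexity M N (normalizeRows P) (normalizeRows Q) ≤ D ∧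
      X = normalizeRows P * (normalizeRows Q)ᵀ}

/-- A sequence of `T` trials: an entry `(i, j)` and a label in `{-1, 1}` per trial. -/
abbrev Trials (m n T : ℕ) : Type := Fin T → (Fin m × Fin n) × ℤˣ

/-- A label as a real number. -/
def lab (y : ℤˣ) : ℝ := ((y : ℤ) : ℝ)

/-- `hloss(S, (P, Q), γ)`. -/
def hlossPair {m n d T : ℕ} (S : Trials m n T) (P : Matrix (Fin m) (Fin d) ℝ)
    (Q : Matrix (Fin n) (Fin d) ℝ) (γ : ℝ) : ℝ :=
  ∑ t, hinge γ (lab (S t).2 * (P (S t).1.1 ⬝ᵥ Q (S t).1.2) /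
    (rowNorm P (S t).1.1 * rowNorm Q (S t).1.2))

/-- `hloss(S, γ)`: the minimum of `hloss(S, (P, Q), γ)` over all `P`, `Q` with `P̄ Q̄ᵀ ∈ 𝒳`. -/
def hloss {m n T : ℕ} (M : Matrix (Fin m) (Fin m) ℝ) (N : Matrix (Fin n) (Fin n) ℝ)
    (D : ℝ) (S : Trials m n T) (γ : ℝ) : ℝ :=
  sInf {v | ∃ (d : ℕ) (P : Matrix (Fin m) (Fin d) ℝ) (Q : Matrix (Fin n) (Fin d) ℝ),
    NonzeroRows P ∧ NonzeroRows Q ∧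
      normalizeRows P * (normalizeRows Q)ᵀ ∈ competitors M N D ∧ v = hlossPair S P Q γ}

/-- `Γ = diag(√R_M √M, √R_N √N)`, with the positive semidefinite square roots of `M` and `N`
given by the continuous functional calculus. -/
def Gam {m n : ℕ} (M : Matrix (Fin m) (Fin m) ℝ) (N : Matrix (Fin n) (Fin n) ℝ) :
    Matrix (Fin m ⊕ Fin n) (Fin m ⊕ Fin n) ℝ :=
  Matrix.fromBlocks (√(sqRadius M) • cfc Real.sqrt M) 0 0 (√(sqRadius N) • cfc Real.sqrt N)

/-- The decision set `𝒦`. -/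
def decisionSet {m n : ℕ} (M : Matrix (Fin m) (Fin m) ℝ) (N : Matrix (Fin n) (Fin n) ℝ)
    (D : ℝ) : Set (Matrix (Fin m ⊕ Fin n) (Fin m ⊕ Fin n) ℝ) :=
  {W | W.PosSemidef ∧ (∀ i, W i i ≤ 1) ∧ (Gam M N * W * Gam M N).trace ≤ D}

/-- The Frobenius inner product `A • B`. -/
def frob {ι : Type} [Fintype ι] (A B : Matrix ι ι ℝ) : ℝ := ∑ i, ∑ j, A i j * B i j

/-- `Z⟨i,j⟩ = (e_i e_{m+j}ᵀ + e_{m+j} e_iᵀ) / 2`. -/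
def Zmat {m n : ℕ} (p : Fin m × Fin n) : Matrix (Fin m ⊕ Fin n) (Fin m ⊕ Fin n) ℝ :=
  (1 / 2 : ℝ) • (Matrix.single (Sum.inl p.1) (Sum.inr p.2) 1 +
    Matrix.single (Sum.inr p.2) (Sum.inl p.1) 1)

/-- The loss matrix fed in trial `t`, given the predictions `yhat`: `-(y_t / γ) Z_t` if trial `t`
is a mistake, `0` otherwise. -/
def lossMat {m n T : ℕ} (γ : ℝ) (S : Trials m n T) (yhat : Fin T → ℤˣ) (t : Fin T) :
    Matrix (Fin m ⊕ Fin n) (Fin m ⊕ Fin n) ℝ :=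
  if yhat t ≠ (S t).2 then (-lab (S t).2 / γ) • Zmat (S t).1 else 0

/-- The objective minimised after trial `t`:
`-ln det(Γ W Γ + E) + η ∑_{s ≤ t} W • L_s`. -/
def objective {m n T : ℕ} (M : Matrix (Fin m) (Fin m) ℝ) (N : Matrix (Fin n) (Fin n) ℝ)
    (γ η : ℝ) (S : Trials m n T) (yhat : Fin T → ℤˣ) (t : Fin T)
    (W : Matrix (Fin m ⊕ Fin n) (Fin m ⊕ Fin n) ℝ) : ℝ :=
  -Real.log (Gam M N * W * Gam M N + 1).det +
    η * ∑ s ∈ Finset.Iic t, frob W (lossMat γ S yhat s)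

/-- `y` is a sign of `x`; for `x = 0` either label may be predicted. -/
def IsSign (x : ℝ) (y : ℤˣ) : Prop := (0 < x → y = 1) ∧ (x < 0 → y = -1)

/-- `W_1, …, W_{T+1}` (here `W 0, …, W T`) and the predictions `yhat` form a run, on the trials
`S`, of the mistake-driven follow-the-regularised-leader algorithm for online matrix completion
with parameters `γ`, `η`, `D` and side information `M`, `N`. The initial `W_1 ∈ 𝒦` is arbitrary. -/
structure IsRun {m n T : ℕ} (M : Matrix (Fin m) (Fin m) ℝ) (N : Matrix (Fin n) (Fin n) ℝ)
    (D γ η : ℝ) (S : Trials m n T)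
    (W : Fin (T + 1) → Matrix (Fin m ⊕ Fin n) (Fin m ⊕ Fin n) ℝ) (yhat : Fin T → ℤˣ) :
    Prop where
  init : W 0 ∈ decisionSet M N D
  predict : ∀ t : Fin T, IsSign (frob (W t.castSucc) (Zmat (S t).1)) (yhat t)
  keep : ∀ t : Fin T, yhat t = (S t).2 → W t.succ = W t.castSucc
  update : ∀ t : Fin T, yhat t ≠ (S t).2 →
    W t.succ ∈ decisionSet M N D ∧
      IsMinOn (objective M N γ η S yhat t) (decisionSet M N D) (W t.succ)

/-- The number of mistakes. -/
def mistakes {m n T : ℕ} (S : Trials m n T) (yhat : Fin T → ℤˣ) : ℕ :=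
  (Finset.univ.filter fun t => yhat t ≠ (S t).2).card

end OMC

end

open scoped Matrix

noncomputable section

namespace OMC

/-! The algorithm is follow-the-regularised-leader with linear losses, and the proof needs two
properties of the regulariser R(W) = -ln det(ΓWΓ + E) on 𝒦.

Its range there is at most D: 1 ≤ det(X + E) ≤ exp(tr X) for X = ΓWΓ, and 𝒦 bounds tr X by D
(`regularizer_nonpos`, `neg_le_regularizer`). The dimension m + n never enters, hence no logarithm.

It is strongly convex in each single entry that can be queried (`sq_sub_le_log_det_midpoint`). Up to
a constant, R(W) is -ln det(W + Γ⁻²). A perturbation H of C = W + Γ⁻² changes the midpoint gap by at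
least H_ij² / (C_ii C_jj), and the normalisation by R_M, R_N keeps the diagonal of C at most 2.

A mistake adds a multiple of one entry to the objective, so strong convexity limits how far that
entry moves (`abs_sub_le_of_isMinOn`). The old matrix had the wrong sign there, so the new one gains
at most 1/2 per mistake; the first mistake, made by an arbitrary matrix, may yield a gain of 1/γ
(`IsRun.neg_le_sum_frob`). Be-the-leader compares these gains with any V in 𝒦, which gains at least
1 minus its hinge loss on each mistake. Rearranging gives mistakes ≤ 2D/η + 2/γ + 2·hinge.
Competitors enter 𝒦 as Gram matrices. -/

/-- Cauchy–Schwarz for the entries of `Sᵀ K S`. -/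
theorem sq_apply_transpose_mul_mul_le {ι : Type*} [Fintype ι] (S K : Matrix ι ι ℝ)
    (hK : K.IsHermitian) (i j : ι) :
    ((Sᵀ * K * S) i j) ^ 2 ≤ (K * K).trace * ((Sᵀ * S) i i * (Sᵀ * S) j j) := by
  have h1 : (Sᵀ * K * S) i j = ∑ p : ι × ι, K p.1 p.2 * (S p.1 i * S p.2 j) := by
    rw [Fintype.sum_prod_type_right]
    simp only [Matrix.mul_apply, Matrix.transpose_apply, Finset.sum_mul]
    exact Finset.sum_congr rfl fun _ _ => Finset.sum_congr rfl fun _ _ => by ring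
  have h2 : (K * K).trace = ∑ p : ι × ι, K p.1 p.2 ^ 2 := by
    rw [Fintype.sum_prod_type]
    simp only [Matrix.trace, Matrix.diag, Matrix.mul_apply]
    refine Finset.sum_congr rfl fun a _ => Finset.sum_congr rfl fun b _ => ?_
    have : K b a = K a b := by simpa using hK.apply a b
    rw [this, sq]
  have h3 : (Sᵀ * S) i i * (Sᵀ * S) j j = ∑ p : ι × ι, (S p.1 i * S p.2 j) ^ 2 := by
    rw [Fintype.sum_prod_type]
    simp only [Matrix.mul_apply, Matrix.transpose_apply, Finset.sum_mul_sum]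
    exact Finset.sum_congr rfl fun _ _ => Finset.sum_congr rfl fun _ _ => by ring
  rw [h1, h2, h3]
  exact Finset.sum_mul_sq_le_sq_mul_sq _ _ _

/-! ### Determinant inequalities and strong concavity of log det in one entry. -/

section LogDet

variable {ι : Type*} [Fintype ι] [DecidableEq ι]

/-- `det X ≤ exp (tr X - n)` for a positive semidefinite `X`. -/
theorem det_le_exp_trace_sub_card {X : Matrix ι ι ℝ} (hX : X.PosSemidef) :
    X.det ≤ Real.exp (X.trace - Fintype.card ι) := by
  have h1 := hX.1.det_eq_prod_eigenvalues
  have h2 := hX.1.trace_eq_sum_eigenvalues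
  simp only [RCLike.ofReal_real_eq_id, id] at h1 h2
  have h3 : X.trace - Fintype.card ι = ∑ i, (hX.1.eigenvalues i - 1) := by
    rw [h2, Finset.sum_sub_distrib]; simp
  rw [h1, h3, Real.exp_sum]
  refine Finset.prod_le_prod (fun i _ => hX.eigenvalues_nonneg i) fun i _ => ?_
  have := Real.add_one_le_exp (hX.1.eigenvalues i - 1)
  linarith

theorem one_le_det_add_one {X : Matrix ι ι ℝ} (hX : X.PosSemidef) : 1 ≤ (X + 1).det := by
  have hA : (X + 1).PosSemidef := hX.add Matrix.PosSemidef.one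
  have h1 := hA.1.det_eq_prod_eigenvalues
  simp only [RCLike.ofReal_real_eq_id, id] at h1
  rw [h1]
  refine Finset.one_le_prod fun i _ => ?_
  have h2 := hA.1.eigenvalues_eq i
  set v := hA.1.eigenvectorBasis i
  have h3 : (star (v : ι → ℝ)) ⬝ᵥ (v : ι → ℝ) = 1 := by
    have := hA.1.eigenvectorBasis.orthonormal.1 i
    have h4 : inner ℝ v v = (1 : ℝ) := by rw [real_inner_self_eq_norm_sq, this]; norm_num
    rw [← h4, EuclideanSpace.inner_eq_star_dotProduct, dotProduct_comm]
  have h5 := hX.dotProduct_mulVec_nonneg (v : ι → ℝ)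
  rw [h2, Matrix.add_mulVec, Matrix.one_mulVec, dotProduct_add, h3]
  simpa using h5

theorem det_add_one_le_exp_trace {X : Matrix ι ι ℝ} (hX : X.PosSemidef) :
    (X + 1).det ≤ Real.exp X.trace := by
  have := det_le_exp_trace_sub_card (hX.add Matrix.PosSemidef.one)
  simpa [Matrix.trace_add] using this

/-- If `1 ± K` are positive semidefinite, then `det (1 + K) det (1 - K) ≤ exp (-tr K²)`. -/
theorem det_one_add_mul_det_one_sub_le {K : Matrix ι ι ℝ} (hp : (1 + K).PosSemidef)
    (hm : (1 - K).PosSemidef) :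
    (1 + K).det * (1 - K).det ≤ Real.exp (-(K * K).trace) := by
  have h1 : ((1 + K) * (1 - K)).PosSemidef := by
    -- With A = 1 + K and B = 1 - K, which commute and sum to 2, ABA + BAB = 2AB. This writes AB as
    -- a sum of congruences of positive semidefinite matrices.
    have e : (1 + K) * (1 - K) = (1 / 2 : ℝ) • ((1 + K)ᴴ * (1 - K) * (1 + K) +
        (1 - K)ᴴ * (1 + K) * (1 - K)) := by
      rw [hp.1.eq, hm.1.eq]
      have : (1 + K) * (1 - K) * (1 + K) + (1 - K) * (1 + K) * (1 - K) =
        (2 : ℝ) • ((1 + K) * (1 - K)) := by rw [two_smul]; noncomm_ring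
      rw [this, smul_smul]; norm_num
    rw [e]
    exact ((hm.conjTranspose_mul_mul_same _).add (hp.conjTranspose_mul_mul_same _)).smul
      (by norm_num)
  have h2 := det_le_exp_trace_sub_card h1
  have h3 : (1 + K) * (1 - K) = 1 - K * K := by noncomm_ring
  rw [Matrix.det_mul] at h2
  rw [h3, Matrix.trace_sub, Matrix.trace_one] at h2
  simpa using h2

theorem exists_transpose_mul_self {C : Matrix ι ι ℝ} (hC : C.PosSemidef) :
    ∃ S : Matrix ι ι ℝ, C = Sᵀ * S := by
  open scoped MatrixOrder in
  obtain ⟨S, hS⟩ := CStarAlgebra.nonneg_iff_eq_star_mul_self.1 hC.nonneg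
  exact ⟨S, by simpa [Matrix.star_eq_conjTranspose] using hS⟩

/-- Strong midpoint concavity of `log det` with respect to a single entry. -/
theorem log_det_midpoint {C H : Matrix ι ι ℝ} (hC : C.PosDef) (hp : (C + H).PosDef)
    (hm : (C - H).PosDef) (i j : ι) :
    H i j ^ 2 ≤ C i i * C j j *
      (2 * Real.log C.det - Real.log (C + H).det - Real.log (C - H).det) := by
  obtain ⟨S, rfl⟩ := exists_transpose_mul_self hC.posSemidef
  have hdet : S.det ≠ 0 := by
    intro h
    have := hC.det_pos
    simp [h] at this
  have hu : IsUnit S.det := isUnit_iff_ne_zero.2 hdet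
  have huT : IsUnit Sᵀ.det := by rwa [Matrix.det_transpose]
  -- Congruence by S⁻¹ turns C into the identity and C ± H into 1 ± K; the gap in log det is then at
  -- least tr K², and tr K² controls the entries of H = SᵀKS.
  set K : Matrix ι ι ℝ := (S⁻¹)ᵀ * H * S⁻¹ with hK
  have hT : Sᵀ * (S⁻¹)ᵀ = 1 := by rw [← Matrix.transpose_mul, Matrix.nonsing_inv_mul _ hu]; simp
  have hT' : (S⁻¹)ᵀ * Sᵀ = 1 := by rw [← Matrix.transpose_mul, Matrix.mul_nonsing_inv _ hu]; simp
  have hH : H = Sᵀ * K * S := by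
    have : Sᵀ * K * S = (Sᵀ * (S⁻¹)ᵀ) * H * (S⁻¹ * S) := by rw [hK]; noncomm_ring
    rw [this, hT, Matrix.nonsing_inv_mul _ hu]; simp
  have key : ∀ X : Matrix ι ι ℝ, (S⁻¹)ᵀ * (Sᵀ * X * S) * S⁻¹ = X := by
    intro X
    have : (S⁻¹)ᵀ * (Sᵀ * X * S) * S⁻¹ = ((S⁻¹)ᵀ * Sᵀ) * X * (S * S⁻¹) := by noncomm_ring
    rw [this, hT', Matrix.mul_nonsing_inv _ hu]; simp
  have ep : Sᵀ * S + H = Sᵀ * (1 + K) * S := by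
    conv_lhs => rw [hH]
    noncomm_ring
  have em : Sᵀ * S - H = Sᵀ * (1 - K) * S := by
    conv_lhs => rw [hH]
    noncomm_ring
  have hp' : (1 + K).PosSemidef := by
    have := hp.posSemidef.conjTranspose_mul_mul_same S⁻¹
    rwa [ep, Matrix.conjTranspose_eq_transpose_of_trivial, key] at this
  have hm' : (1 - K).PosSemidef := by
    have := hm.posSemidef.conjTranspose_mul_mul_same S⁻¹
    rwa [em, Matrix.conjTranspose_eq_transpose_of_trivial, key] at this
  have hKh : K.IsHermitian := by
    have := hp'.1.sub (Matrix.isHermitian_one (n := ι) (α := ℝ))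
    simpa using this
  have h1 := sq_apply_transpose_mul_mul_le S K hKh i j
  rw [← hH] at h1
  have h2 := det_one_add_mul_det_one_sub_le hp' hm'
  have hdp := hp.det_pos
  have hdm := hm.det_pos
  have hdC := hC.det_pos
  have e1 : (Sᵀ * S + H).det * (Sᵀ * S - H).det =
      ((Sᵀ * S).det * (Sᵀ * S).det) * ((1 + K).det * (1 - K).det) := by
    rw [ep, em]; simp only [Matrix.det_mul]; ring
  have h3 : Real.log (Sᵀ * S + H).det + Real.log (Sᵀ * S - H).det ≤
      2 * Real.log (Sᵀ * S).det - (K * K).trace := by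
    rw [← Real.log_mul hdp.ne' hdm.ne']
    have h4 : (Sᵀ * S + H).det * (Sᵀ * S - H).det ≤
        ((Sᵀ * S).det * (Sᵀ * S).det) * Real.exp (-(K * K).trace) := by
      rw [e1]; exact mul_le_mul_of_nonneg_left h2 (by positivity)
    refine (Real.log_le_log (by positivity) h4).trans ?_
    rw [Real.log_mul (by positivity) (by positivity), Real.log_mul hdC.ne' hdC.ne', Real.log_exp]
    linarith
  refine h1.trans ?_
  rw [mul_comm]
  refine mul_le_mul_of_nonneg_left (by linarith) ?_
  exact mul_nonneg hC.posSemidef.diag_nonneg hC.posSemidef.diag_nonneg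

/-- Cauchy–Schwarz for Gram vectors of norm at most 1. It serves compactness, the first mistake and
the case of large γ. -/
theorem abs_apply_le_one {W : Matrix ι ι ℝ} (hW : W.PosSemidef) (hd : ∀ i, W i i ≤ 1) (i j : ι) :
    |W i j| ≤ 1 := by
  obtain ⟨S, rfl⟩ := exists_transpose_mul_self hW
  have h : (Sᵀ * S) i j ^ 2 ≤ (Sᵀ * S) i i * (Sᵀ * S) j j := by
    have := Finset.sum_mul_sq_le_sq_mul_sq Finset.univ (fun a => S a i) (fun a => S a j)
    simpa [Matrix.mul_apply, sq] using this
  have h0 := hW.diag_nonneg (i := i)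
  have h0' := hW.diag_nonneg (i := j)
  rw [← sq_le_one_iff_abs_le_one]
  exact h.trans (mul_le_one₀ (hd i) h0' (hd j))

end LogDet

/-- Strong midpoint convexity of `W ↦ -log det (Γ W Γ + 1)` on positive semidefinite matrices with
diagonal at most `1`, with respect to a single entry. -/
theorem sq_sub_le_log_det_midpoint {ι : Type*} [Fintype ι] [DecidableEq ι] {Γ W W' : Matrix ι ι ℝ}
    (hΓ : Γ.IsHermitian) (hu : IsUnit Γ.det) (hB : ∀ i, (Γ * Γ)⁻¹ i i ≤ 1)
    (hW : W.PosSemidef) (hW' : W'.PosSemidef) (hd : ∀ i, W i i ≤ 1) (hd' : ∀ i, W' i i ≤ 1)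
    (i j : ι) :
    (W i j - W' i j) ^ 2 / 16 ≤ 2 * Real.log (Γ * ((1 / 2 : ℝ) • (W + W')) * Γ + 1).det
      - Real.log (Γ * W * Γ + 1).det - Real.log (Γ * W' * Γ + 1).det := by
  have hBpos : (Γ * Γ)⁻¹.PosDef := by
    have h := Matrix.PosDef.conjTranspose_mul_self Γ
      (Matrix.mulVec_injective_iff_isUnit.2 ((Matrix.isUnit_iff_isUnit_det _).2 hu))
    rw [hΓ.eq] at h
    exact h.inv
  have hdet : Γ.det ≠ 0 := hu.ne_zero
  set B := (Γ * Γ)⁻¹ with hBdef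
  have hone : Γ * B * Γ = 1 := by
    rw [hBdef, Matrix.mul_inv_rev, ← Matrix.mul_assoc, Matrix.mul_nonsing_inv _ hu,
      Matrix.one_mul, Matrix.nonsing_inv_mul _ hu]
  -- Pulling Γ out of the determinant leaves a constant, which cancels in the second difference.
  have hlog : ∀ X : Matrix ι ι ℝ, X.PosSemidef →
      Real.log (Γ * X * Γ + 1).det = Real.log (Γ.det ^ 2) + Real.log (X + B).det := by
    intro X hX
    have e : Γ * X * Γ + 1 = Γ * (X + B) * Γ := by rw [← hone]; noncomm_ring
    rw [e, Matrix.det_mul, Matrix.det_mul, ← Real.log_mul (pow_ne_zero _ hdet)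
      (Matrix.PosDef.posSemidef_add hX hBpos).det_pos.ne']
    congr 1; ring
  have hmid : ((1 / 2 : ℝ) • (W + W')).PosSemidef := (hW.add hW').smul (by norm_num)
  rw [hlog _ hmid, hlog _ hW, hlog _ hW']
  set C := (1 / 2 : ℝ) • (W + W') + B with hC
  set H := (1 / 2 : ℝ) • (W - W') with hH
  have e1 : C + H = W + B := by
    ext a b; simp [hC, hH]; ring
  have e2 : C - H = W' + B := by
    ext a b; simp [hC, hH]; ring
  have hCpos : C.PosDef := Matrix.PosDef.posSemidef_add hmid hBpos
  have key := log_det_midpoint (H := H) hCpos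
    (e1 ▸ Matrix.PosDef.posSemidef_add hW hBpos) (e2 ▸ Matrix.PosDef.posSemidef_add hW' hBpos) i j
  rw [e1, e2] at key
  -- 1 from the midpoint of W and W', 1 from B. Hence C_ii C_jj ≤ 4, and since H is half of W - W'
  -- the constant becomes 1/16.
  have hCd : ∀ k, C k k ≤ 2 := by
    intro k
    have h1 := hd k
    have h2 := hd' k
    have h3 := hB k
    simp only [hC, Matrix.add_apply, Matrix.smul_apply, smul_eq_mul]
    linarith
  have h0 := hCpos.diag_pos (i := i)
  have h0' := hCpos.diag_pos (i := j)
  have hprod : C i i * C j j ≤ 4 := by nlinarith [hCd i, hCd j]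
  set g := 2 * Real.log C.det - Real.log (W + B).det - Real.log (W' + B).det with hg
  have hg0 : 0 ≤ g := nonneg_of_mul_nonneg_right ((sq_nonneg _).trans key) (by positivity)
  have h4 : H i j ^ 2 ≤ 4 * g := key.trans (mul_le_mul_of_nonneg_right hprod hg0)
  have h5 : H i j = (1 / 2) * (W i j - W' i j) := by simp [hH]
  rw [h5] at h4
  nlinarith

/-! ### The matrix Γ, the regulariser and the compact decision set. -/

section SideInformation

variable {m n : ℕ} {M : Matrix (Fin m) (Fin m) ℝ} {N : Matrix (Fin n) (Fin n) ℝ}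

theorem inv_apply_le_sqRadius {k : ℕ} (M : Matrix (Fin k) (Fin k) ℝ) (i : Fin k) :
    M⁻¹ i i ≤ sqRadius M :=
  le_ciSup (f := fun i => M⁻¹ i i) (Set.finite_range _).bddAbove i

theorem sqRadius_pos {k : ℕ} {M : Matrix (Fin k) (Fin k) ℝ} (hM : M.PosDef) (i : Fin k) :
    0 < sqRadius M :=
  hM.inv.diag_pos.trans_le (inv_apply_le_sqRadius M i)

theorem sqRadius_nonneg {k : ℕ} {M : Matrix (Fin k) (Fin k) ℝ} (hM : M.PosDef) :
    0 ≤ sqRadius M :=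
  Real.iSup_nonneg fun _ => hM.inv.diag_pos.le

theorem cfc_sqrt_mul_self {k : ℕ} {M : Matrix (Fin k) (Fin k) ℝ} (hM : M.PosSemidef) :
    cfc Real.sqrt M * cfc Real.sqrt M = M := by
  have hs := (Matrix.posSemidef_iff_isHermitian_and_spectrum_nonneg.1 hM).2
  have ha : IsSelfAdjoint M := hM.1
  rw [← cfc_mul Real.sqrt Real.sqrt M]
  conv_rhs => rw [← cfc_id ℝ M]
  exact cfc_congr fun x hx => Real.mul_self_sqrt (hs hx)

theorem gam_isHermitian (M : Matrix (Fin m) (Fin m) ℝ) (N : Matrix (Fin n) (Fin n) ℝ) :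
    (Gam M N).IsHermitian := by
  have h : ∀ {k : ℕ} (A : Matrix (Fin k) (Fin k) ℝ), (cfc Real.sqrt A).IsHermitian :=
    fun A => cfc_predicate (p := IsSelfAdjoint) Real.sqrt A
  unfold Gam
  refine Matrix.IsHermitian.fromBlocks ?_ (by simp) ?_
  · exact (IsSelfAdjoint.all _).smul (h M)
  · exact (IsSelfAdjoint.all _).smul (h N)

theorem gam_mul_gam (hM : M.PosDef) (hN : N.PosDef) :
    Gam M N * Gam M N = Matrix.fromBlocks (sqRadius M • M) 0 0 (sqRadius N • N) := by
  simp [Gam, Matrix.fromBlocks_multiply, smul_smul, cfc_sqrt_mul_self hM.posSemidef,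
    cfc_sqrt_mul_self hN.posSemidef, Real.mul_self_sqrt (sqRadius_nonneg hM),
    Real.mul_self_sqrt (sqRadius_nonneg hN)]

theorem gam_mul_gam_inv (hM : M.PosDef) (hN : N.PosDef) (i : Fin m) (j : Fin n) :
    (Gam M N * Gam M N)⁻¹ =
      Matrix.fromBlocks ((sqRadius M)⁻¹ • M⁻¹) 0 0 ((sqRadius N)⁻¹ • N⁻¹) := by
  apply Matrix.inv_eq_left_inv
  have h1 := (Matrix.isUnit_iff_isUnit_det _).1 hM.isUnit
  have h2 := (Matrix.isUnit_iff_isUnit_det _).1 hN.isUnit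
  simp [gam_mul_gam hM hN, Matrix.fromBlocks_multiply, Matrix.nonsing_inv_mul _ h1,
    Matrix.nonsing_inv_mul _ h2, smul_smul, (sqRadius_pos hM i).ne', (sqRadius_pos hN j).ne']

theorem isUnit_det_gam (hM : M.PosDef) (hN : N.PosDef) (i : Fin m) (j : Fin n) :
    IsUnit (Gam M N).det := by
  rw [isUnit_iff_ne_zero]
  intro h
  have h1 : (Gam M N * Gam M N).det = 0 := by rw [Matrix.det_mul, h, zero_mul]
  rw [gam_mul_gam hM hN, Matrix.det_fromBlocks_zero₂₁, Matrix.det_smul, Matrix.det_smul] at h1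
  have := hM.det_pos
  have := hN.det_pos
  have := sqRadius_pos hM i
  have := sqRadius_pos hN j
  have : 0 < sqRadius M ^ Fintype.card (Fin m) * M.det *
    (sqRadius N ^ Fintype.card (Fin n) * N.det) := by positivity
  exact this.ne' h1

/-- This is what the factors R_M and R_N are for: they rescale the inverses so that no diagonal
entry exceeds 1. The indices `i`, `j` only ensure that both blocks are nonempty, so that the radii
are positive. -/
theorem gam_mul_gam_inv_diag_le (hM : M.PosDef) (hN : N.PosDef) (i : Fin m) (j : Fin n)
    (k : Fin m ⊕ Fin n) : (Gam M N * Gam M N)⁻¹ k k ≤ 1 := by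
  rw [gam_mul_gam_inv hM hN i j]
  rcases k with k | k
  · simpa [← div_eq_inv_mul, div_le_one (sqRadius_pos hM i)] using inv_apply_le_sqRadius M k
  · simpa [← div_eq_inv_mul, div_le_one (sqRadius_pos hN j)] using inv_apply_le_sqRadius N k

theorem trace_gam_mul_mul_gam (hM : M.PosDef) (hN : N.PosDef)
    (W : Matrix (Fin m ⊕ Fin n) (Fin m ⊕ Fin n) ℝ) :
    (Gam M N * W * Gam M N).trace =
      sqRadius M * (M * W.toBlocks₁₁).trace + sqRadius N * (N * W.toBlocks₂₂).trace := by
  rw [Matrix.mul_assoc, Matrix.trace_mul_comm, Matrix.mul_assoc, Matrix.trace_mul_comm,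
    gam_mul_gam hM hN]
  conv_lhs => rw [← Matrix.fromBlocks_toBlocks W]
  simp [Matrix.fromBlocks_multiply, Matrix.trace, Fintype.sum_sum_type, Finset.mul_sum]

/-- The regulariser `-ln det (Γ W Γ + E)`. -/
def regularizer (M : Matrix (Fin m) (Fin m) ℝ) (N : Matrix (Fin n) (Fin n) ℝ)
    (W : Matrix (Fin m ⊕ Fin n) (Fin m ⊕ Fin n) ℝ) : ℝ :=
  -Real.log (Gam M N * W * Gam M N + 1).det

theorem posSemidef_gam_mul_mul_gam {W : Matrix (Fin m ⊕ Fin n) (Fin m ⊕ Fin n) ℝ}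
    (hW : W.PosSemidef) : (Gam M N * W * Gam M N).PosSemidef := by
  have := hW.conjTranspose_mul_mul_same (Gam M N)
  rwa [(gam_isHermitian M N).eq] at this

theorem regularizer_nonpos {W : Matrix (Fin m ⊕ Fin n) (Fin m ⊕ Fin n) ℝ} {D : ℝ}
    (hW : W ∈ decisionSet M N D) : regularizer M N W ≤ 0 :=
  neg_nonpos.2 (Real.log_nonneg (one_le_det_add_one (posSemidef_gam_mul_mul_gam hW.1)))

/-- From ln det(X + E) ≤ tr X and the trace constraint of 𝒦: the bound is free of the dimension. -/
theorem neg_le_regularizer {W : Matrix (Fin m ⊕ Fin n) (Fin m ⊕ Fin n) ℝ} {D : ℝ}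
    (hW : W ∈ decisionSet M N D) : -D ≤ regularizer M N W := by
  have hp := posSemidef_gam_mul_mul_gam (M := M) (N := N) hW.1
  have h := Real.log_le_log (zero_lt_one.trans_le (one_le_det_add_one hp))
    (det_add_one_le_exp_trace hp)
  rw [Real.log_exp] at h
  exact neg_le_neg (h.trans hW.2.2)

theorem midpoint_mem_decisionSet {W W' : Matrix (Fin m ⊕ Fin n) (Fin m ⊕ Fin n) ℝ} {D : ℝ}
    (hW : W ∈ decisionSet M N D) (hW' : W' ∈ decisionSet M N D) :
    (1 / 2 : ℝ) • (W + W') ∈ decisionSet M N D := by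
  refine ⟨(hW.1.add hW'.1).smul (by norm_num), fun i => ?_, ?_⟩
  · have h1 := hW.2.1 i
    have h2 := hW'.2.1 i
    simp only [Matrix.smul_apply, Matrix.add_apply, smul_eq_mul]
    linarith
  · have h1 := hW.2.2
    have h2 := hW'.2.2
    rw [Matrix.mul_smul, Matrix.smul_mul, Matrix.mul_add, Matrix.add_mul, Matrix.trace_smul,
      Matrix.trace_add, smul_eq_mul]
    linarith

theorem sq_sub_le_regularizer (hM : M.PosDef) (hN : N.PosDef)
    {W W' : Matrix (Fin m ⊕ Fin n) (Fin m ⊕ Fin n) ℝ} {D : ℝ}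
    (hW : W ∈ decisionSet M N D) (hW' : W' ∈ decisionSet M N D) (i : Fin m) (j : Fin n) :
    (W (Sum.inl i) (Sum.inr j) - W' (Sum.inl i) (Sum.inr j)) ^ 2 / 16 ≤
      regularizer M N W + regularizer M N W' - 2 * regularizer M N ((1 / 2 : ℝ) • (W + W')) := by
  have := sq_sub_le_log_det_midpoint (gam_isHermitian M N) (isUnit_det_gam hM hN i j)
    (gam_mul_gam_inv_diag_le hM hN i j) hW.1 hW'.1 hW.2.1 hW'.2.1 (Sum.inl i) (Sum.inr j)
  unfold regularizer
  linarith

/-- Positive semidefiniteness is an intersection of closed conditions, one per vector, and the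
diagonal bound confines all entries to [-1, 1]. -/
theorem isCompact_posSemidef_diag_le {ι : Type*} [Fintype ι] [DecidableEq ι] :
    IsCompact {W : Matrix ι ι ℝ | W.PosSemidef ∧ ∀ i, W i i ≤ 1} := by
  have hbox : IsCompact (Set.pi Set.univ fun _ : ι => Set.pi Set.univ fun _ : ι =>
      Set.Icc (-1 : ℝ) 1) :=
    isCompact_univ_pi fun _ => isCompact_univ_pi fun _ => isCompact_Icc
  refine hbox.of_isClosed_subset ?_ ?_
  · have : {W : Matrix ι ι ℝ | W.PosSemidef ∧ ∀ i, W i i ≤ 1} =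
        {W : Matrix ι ι ℝ | Wᴴ = W} ∩ (⋂ x : ι → ℝ, {W | 0 ≤ star x ⬝ᵥ (W *ᵥ x)}) ∩
          ⋂ i, {W | W i i ≤ 1} := by
      ext W
      simp [Matrix.posSemidef_iff_dotProduct_mulVec, Matrix.IsHermitian]
    rw [this]
    refine ((isClosed_eq (by fun_prop) (by fun_prop)).inter (isClosed_iInter fun x => ?_)).inter
      (isClosed_iInter fun i => ?_)
    · exact isClosed_le (by fun_prop) (by fun_prop)
    · exact isClosed_le (by fun_prop) (by fun_prop)
  · rintro W ⟨h1, h2⟩ i - j -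
    exact abs_le.1 (abs_apply_le_one h1 h2 i j)

theorem isCompact_decisionSet (M : Matrix (Fin m) (Fin m) ℝ) (N : Matrix (Fin n) (Fin n) ℝ)
    (D : ℝ) : IsCompact (decisionSet M N D) := by
  have : decisionSet M N D = {W | W.PosSemidef ∧ ∀ i, W i i ≤ 1} ∩
      {W | (Gam M N * W * Gam M N).trace ≤ D} := by
    ext W; simp [decisionSet, and_assoc]
  rw [this]
  exact isCompact_posSemidef_diag_le.inter_right (isClosed_le (by fun_prop) (by fun_prop))

theorem continuousOn_regularizer (M : Matrix (Fin m) (Fin m) ℝ) (N : Matrix (Fin n) (Fin n) ℝ)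
    (D : ℝ) : ContinuousOn (regularizer M N) (decisionSet M N D) := by
  refine ContinuousOn.neg (ContinuousOn.log (Continuous.continuousOn (by fun_prop)) fun W hW => ?_)
  exact (zero_lt_one.trans_le (one_le_det_add_one (posSemidef_gam_mul_mul_gam hW.1))).ne'

end SideInformation

/-! ### Factorisations as Gram matrices. -/

section Gram

variable {m n d : ℕ} {M : Matrix (Fin m) (Fin m) ℝ} {N : Matrix (Fin n) (Fin n) ℝ}

theorem rowNorm_sq {k l : ℕ} (A : Matrix (Fin k) (Fin l) ℝ) (i : Fin k) :
    rowNorm A i ^ 2 = ∑ j, A i j ^ 2 :=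
  Real.sq_sqrt (Finset.sum_nonneg fun _ _ => sq_nonneg _)

theorem rowNorm_pos {k l : ℕ} {A : Matrix (Fin k) (Fin l) ℝ} (hA : NonzeroRows A) (i : Fin k) :
    0 < rowNorm A i := by
  obtain ⟨j, hj⟩ := Function.ne_iff.1 (hA i)
  exact Real.sqrt_pos.2 (Finset.sum_pos' (fun _ _ => sq_nonneg _)
    ⟨j, Finset.mem_univ _, by have : A i j ≠ 0 := hj; positivity⟩)

theorem normalizeRows_mem {k l : ℕ} {A : Matrix (Fin k) (Fin l) ℝ} (hA : NonzeroRows A) :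
    normalizeRows A ∈ rowNormalized k l := by
  intro i
  have h := rowNorm_pos hA i
  have : rowNorm (normalizeRows A) i ^ 2 = 1 := by
    rw [rowNorm_sq]
    simp only [normalizeRows, Matrix.diagonal_mul, mul_pow, ← Finset.mul_sum]
    rw [← rowNorm_sq]
    field_simp
  exact (pow_eq_one_iff_of_nonneg (Real.sqrt_nonneg _) two_ne_zero).1 this

theorem normalizeRows_eq_self {k l : ℕ} {A : Matrix (Fin k) (Fin l) ℝ}
    (hA : A ∈ rowNormalized k l) : normalizeRows A = A := by
  have h : ∀ i, rowNorm A i = 1 := hA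
  simp [normalizeRows, h]

theorem nonzeroRows_of_rowNormalized {k l : ℕ} {A : Matrix (Fin k) (Fin l) ℝ}
    (hA : A ∈ rowNormalized k l) : NonzeroRows A := by
  intro i hi
  have h : rowNorm A i = 1 := hA i
  simp [rowNorm, hi] at h

theorem mem_rowNormalized_iff {k l : ℕ} {A : Matrix (Fin k) (Fin l) ℝ} :
    A ∈ rowNormalized k l ↔ ∀ i, (A * Aᵀ) i i = 1 := by
  refine forall_congr' fun i => ?_
  rw [rowNorm, Real.sqrt_eq_one]
  simp [Matrix.mul_apply, sq]

/-- The Gram matrix of the rows of `P` and `Q`. -/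
def gram (P : Matrix (Fin m) (Fin d) ℝ) (Q : Matrix (Fin n) (Fin d) ℝ) :
    Matrix (Fin m ⊕ Fin n) (Fin m ⊕ Fin n) ℝ :=
  Matrix.fromBlocks (P * Pᵀ) (P * Qᵀ) (Q * Pᵀ) (Q * Qᵀ)

theorem gram_posSemidef (P : Matrix (Fin m) (Fin d) ℝ) (Q : Matrix (Fin n) (Fin d) ℝ) :
    (gram P Q).PosSemidef := by
  have : gram P Q = Matrix.fromRows P Q * (Matrix.fromRows P Q)ᴴ := by
    rw [Matrix.conjTranspose_eq_transpose_of_trivial, Matrix.transpose_fromRows,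
      Matrix.fromRows_mul_fromCols, gram]
  rw [this]
  exact Matrix.posSemidef_self_mul_conjTranspose _

theorem gram_diag {P : Matrix (Fin m) (Fin d) ℝ} {Q : Matrix (Fin n) (Fin d) ℝ}
    (hP : P ∈ rowNormalized m d) (hQ : Q ∈ rowNormalized n d) (i : Fin m ⊕ Fin n) :
    gram P Q i i = 1 := by
  rcases i with i | i
  · exact mem_rowNormalized_iff.1 hP i
  · exact mem_rowNormalized_iff.1 hQ i

theorem trace_gam_gram (hM : M.PosDef) (hN : N.PosDef) (P : Matrix (Fin m) (Fin d) ℝ)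
    (Q : Matrix (Fin n) (Fin d) ℝ) :
    (Gam M N * gram P Q * Gam M N).trace = sideComplexity M N P Q := by
  rw [trace_gam_mul_mul_gam hM hN, gram, Matrix.toBlocks_fromBlocks₁₁,
    Matrix.toBlocks_fromBlocks₂₂, sideComplexity, ← Matrix.mul_assoc, ← Matrix.mul_assoc,
    Matrix.trace_mul_comm (M * P), Matrix.trace_mul_comm (N * Q), Matrix.mul_assoc,
    Matrix.mul_assoc]

/-- The columns of a square root serve as row vectors. Inner dimension m + n therefore suffices for
every factorisation, which lets one compact set replace the union over all d. -/
theorem exists_gram_eq {G : Matrix (Fin m ⊕ Fin n) (Fin m ⊕ Fin n) ℝ} (hG : G.PosSemidef) :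
    ∃ (P : Matrix (Fin m) (Fin (m + n)) ℝ) (Q : Matrix (Fin n) (Fin (m + n)) ℝ),
      gram P Q = G := by
  obtain ⟨S, rfl⟩ := exists_transpose_mul_self hG
  refine ⟨Sᵀ.submatrix Sum.inl finSumFinEquiv.symm, Sᵀ.submatrix Sum.inr finSumFinEquiv.symm, ?_⟩
  ext (i | i) (j | j) <;>
    exact Fintype.sum_equiv finSumFinEquiv.symm _ _ fun _ => rfl

theorem gram_mem_decisionSet (hM : M.PosDef) (hN : N.PosDef) {P : Matrix (Fin m) (Fin d) ℝ}
    {Q : Matrix (Fin n) (Fin d) ℝ} {D : ℝ} (hP : P ∈ rowNormalized m d)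
    (hQ : Q ∈ rowNormalized n d) (hD : sideComplexity M N P Q ≤ D) :
    gram P Q ∈ decisionSet M N D :=
  ⟨gram_posSemidef P Q, fun i => (gram_diag hP hQ i).le, (trace_gam_gram hM hN P Q).trans_le hD⟩

/-- The infimum defining the quasi-dimension is attained. -/
theorem exists_sideComplexity_le (hM : M.PosDef) (hN : N.PosDef) {U : Matrix (Fin m) (Fin n) ℝ}
    {γ D : ℝ} (hne : (quasiDimValues M N γ U).Nonempty) (hD : quasiDim M N γ U ≤ D) :
    ∃ (P : Matrix (Fin m) (Fin (m + n)) ℝ) (Q : Matrix (Fin n) (Fin (m + n)) ℝ),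
      P ∈ rowNormalized m (m + n) ∧ Q ∈ rowNormalized n (m + n) ∧ P * Qᵀ = γ • U ∧
        sideComplexity M N P Q ≤ D := by
  -- The Gram matrices of admissible factorisations. On this compact set the side complexity is a
  -- continuous linear function of W.
  set A : Set (Matrix (Fin m ⊕ Fin n) (Fin m ⊕ Fin n) ℝ) :=
    {W | W.PosSemidef ∧ ∀ i, W i i ≤ 1} ∩ ({W | ∀ i, W i i = 1} ∩ {W | W.toBlocks₁₂ = γ • U})
    with hA
  have hclosed : IsClosed ({W : Matrix (Fin m ⊕ Fin n) (Fin m ⊕ Fin n) ℝ | ∀ i, W i i = 1} ∩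
      {W | W.toBlocks₁₂ = γ • U}) := by
    refine IsClosed.inter ?_ ?_
    · simp only [Set.ofPred_forall]
      exact isClosed_iInter fun i => isClosed_eq (by fun_prop) (by fun_prop)
    · exact isClosed_eq (by unfold Matrix.toBlocks₁₂; fun_prop) (by fun_prop)
  have hmem : ∀ {d : ℕ} {P : Matrix (Fin m) (Fin d) ℝ} {Q : Matrix (Fin n) (Fin d) ℝ},
      P ∈ rowNormalized m d → Q ∈ rowNormalized n d → P * Qᵀ = γ • U → gram P Q ∈ A :=
    fun hP hQ h => ⟨⟨gram_posSemidef _ _, fun i => (gram_diag hP hQ i).le⟩, gram_diag hP hQ, h⟩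
  have hAne : A.Nonempty := by
    obtain ⟨v, d, P, Q, hP, hQ, h, -⟩ := hne
    exact ⟨_, hmem hP hQ h⟩
  obtain ⟨G, hG, hmin⟩ := (isCompact_posSemidef_diag_le.inter_right hclosed).exists_isMinOn hAne
    (f := fun W => (Gam M N * W * Gam M N).trace) (Continuous.continuousOn (by fun_prop))
  obtain ⟨P, Q, rfl⟩ := exists_gram_eq hG.1.1
  refine ⟨P, Q, mem_rowNormalized_iff.2 fun i => hG.2.1 (Sum.inl i),
    mem_rowNormalized_iff.2 fun i => hG.2.1 (Sum.inr i), hG.2.2, le_trans ?_ hD⟩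
  refine le_csInf hne ?_
  rintro v ⟨d, P', Q', hP, hQ, h, rfl⟩
  rw [← trace_gam_gram hM hN, ← trace_gam_gram hM hN]
  exact hmin (hmem hP hQ h)

theorem normalizeRows_mul_transpose_apply (P : Matrix (Fin m) (Fin d) ℝ)
    (Q : Matrix (Fin n) (Fin d) ℝ) (i : Fin m) (j : Fin n) :
    (normalizeRows P * (normalizeRows Q)ᵀ) i j = P i ⬝ᵥ Q j / (rowNorm P i * rowNorm Q j) := by
  rw [Matrix.mul_apply]
  simp only [normalizeRows, Matrix.transpose_apply, Matrix.diagonal_mul, dotProduct,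
    Finset.sum_div]
  exact Finset.sum_congr rfl fun _ _ => by ring

/-- Each pair admissible in the hinge loss comes from an element of the decision set. -/
theorem exists_decisionSet_hlossPair_eq (hM : M.PosDef) (hN : N.PosDef) {D γ : ℝ} {T : ℕ}
    {S : Trials m n T} {P : Matrix (Fin m) (Fin d) ℝ} {Q : Matrix (Fin n) (Fin d) ℝ}
    (h : normalizeRows P * (normalizeRows Q)ᵀ ∈ competitors M N D) :
    ∃ V ∈ decisionSet M N D, hlossPair S P Q γ =
      ∑ t, hinge γ (lab (S t).2 * V (Sum.inl (S t).1.1) (Sum.inr (S t).1.2)) := by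
  obtain ⟨d', P', Q', hP, hQ, hD, hX⟩ := h
  -- The complexity bound is known for the witnesses `P'`, `Q'`, not for `P`, `Q`; the hinge loss
  -- depends only on the normalised product, which both pairs share.
  refine ⟨gram (normalizeRows P') (normalizeRows Q'),
    gram_mem_decisionSet hM hN (normalizeRows_mem hP) (normalizeRows_mem hQ) hD,
    Finset.sum_congr rfl fun t _ => ?_⟩
  rw [gram, Matrix.fromBlocks_apply₁₂, ← hX, normalizeRows_mul_transpose_apply, mul_div_assoc]

end Gram

/-! ### Hinge loss and the pairing with the query matrices. -/

theorem hinge_nonneg {γ x : ℝ} (hγ : 0 < γ) : 0 ≤ hinge γ x := by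
  unfold hinge
  split_ifs with h
  · exact le_rfl
  · rw [sub_nonneg, div_le_one hγ]; exact (not_le.1 h).le

theorem one_sub_div_le_hinge {γ x : ℝ} (hγ : 0 < γ) : 1 - x / γ ≤ hinge γ x := by
  unfold hinge
  split_ifs with h
  · rw [sub_nonpos, one_le_div hγ]; exact h
  · exact le_rfl

section Frob

variable {ι : Type} [Fintype ι]

theorem frob_smul_right (a : ℝ) (A B : Matrix ι ι ℝ) : frob A (a • B) = a * frob A B := by
  simp only [frob, Finset.mul_sum, Matrix.smul_apply, smul_eq_mul]
  exact Finset.sum_congr rfl fun _ _ => Finset.sum_congr rfl fun _ _ => by ring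

theorem frob_zero_right (A : Matrix ι ι ℝ) : frob A 0 = 0 := by
  simp [frob]

theorem frob_add_right (A B C : Matrix ι ι ℝ) : frob A (B + C) = frob A B + frob A C := by
  simp [frob, mul_add, Finset.sum_add_distrib]

theorem frob_smul_left (a : ℝ) (A B : Matrix ι ι ℝ) : frob (a • A) B = a * frob A B := by
  simp only [frob, Finset.mul_sum, Matrix.smul_apply, smul_eq_mul]
  exact Finset.sum_congr rfl fun _ _ => Finset.sum_congr rfl fun _ _ => by ring

theorem frob_add_left (A B C : Matrix ι ι ℝ) : frob (A + B) C = frob A C + frob B C := by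
  simp [frob, add_mul, Finset.sum_add_distrib]

theorem frob_single_one [DecidableEq ι] (A : Matrix ι ι ℝ) (a b : ι) :
    frob A (Matrix.single a b 1) = A a b := by
  simp [frob, Matrix.single_apply, Finset.sum_ite_eq, ite_and]

theorem frob_Zmat {m n : ℕ} {W : Matrix (Fin m ⊕ Fin n) (Fin m ⊕ Fin n) ℝ} (hW : W.IsHermitian)
    (p : Fin m × Fin n) : frob W (Zmat p) = W (Sum.inl p.1) (Sum.inr p.2) := by
  have : W (Sum.inr p.2) (Sum.inl p.1) = W (Sum.inl p.1) (Sum.inr p.2) := by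
    simpa using hW.apply (Sum.inl p.1) (Sum.inr p.2)
  rw [Zmat, frob_smul_right, frob_add_right, frob_single_one, frob_single_one, this]
  ring

end Frob

/-! ### Partial sums over trials and stability of minimisers. -/

section Trials

variable {m n T : ℕ}

/-- The trials among the first `k`. -/
def before (T k : ℕ) : Finset (Fin T) := Finset.univ.filter fun s => (s : ℕ) < k

theorem before_zero : before T 0 = ∅ := by simp [before]

theorem before_self : before T T = Finset.univ := by simp [before]

theorem before_succ (t : Fin T) : before T (t + 1) = insert t (before T t) := by
  ext s
  simp only [before, Finset.mem_filter, Finset.mem_univ, true_and, Finset.mem_insert, Fin.ext_iff]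
  omega

theorem notMem_before (t : Fin T) : t ∉ before T t := by simp [before]

theorem Iic_eq_before (t : Fin T) : Finset.Iic t = before T (t + 1) := by
  ext s
  rw [Finset.mem_Iic, before, Finset.mem_filter, Fin.le_def, Nat.lt_succ_iff]
  simp

theorem sum_before_succ (t : Fin T) (f : Fin T → ℝ) :
    ∑ s ∈ before T (t + 1), f s = ∑ s ∈ before T t, f s + f t := by
  rw [before_succ, Finset.sum_insert (notMem_before t), add_comm]

theorem lossMat_of_ne {γ : ℝ} {S : Trials m n T} {yhat : Fin T → ℤˣ} {t : Fin T}
    (h : yhat t ≠ (S t).2) : lossMat γ S yhat t = (-lab (S t).2 / γ) • Zmat (S t).1 := if_pos h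

theorem lossMat_of_eq {γ : ℝ} {S : Trials m n T} {yhat : Fin T → ℤˣ} {t : Fin T}
    (h : yhat t = (S t).2) : lossMat γ S yhat t = 0 := if_neg (not_not.2 h)

theorem frob_lossMat_of_ne {γ : ℝ} {S : Trials m n T} {yhat : Fin T → ℤˣ} {t : Fin T}
    (h : yhat t ≠ (S t).2) {W : Matrix (Fin m ⊕ Fin n) (Fin m ⊕ Fin n) ℝ} (hW : W.IsHermitian) :
    frob W (lossMat γ S yhat t) =
      -lab (S t).2 / γ * W (Sum.inl (S t).1.1) (Sum.inr (S t).1.2) := by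
  rw [lossMat_of_ne h, frob_smul_right, frob_Zmat hW]

theorem abs_lab (y : ℤˣ) : |lab y| = 1 := by
  rcases Int.units_eq_one_or y with rfl | rfl <;> simp [lab]

/-- On a mistake, the prediction matrix suffers nonnegative loss. -/
theorem lab_mul_nonpos_of_isSign_of_ne {x : ℝ} {y z : ℤˣ} (h : IsSign x y) (hne : y ≠ z) :
    lab z * x ≤ 0 := by
  rcases Int.units_eq_one_or y with rfl | rfl <;> rcases Int.units_eq_one_or z with rfl | rfl
  · exact absurd rfl hne
  · have : ¬ x < 0 := fun hx => absurd (h.2 hx) (by decide)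
    simpa [lab] using this
  · have : ¬ 0 < x := fun hx => absurd (h.1 hx) (by decide)
    simpa [lab] using this
  · exact absurd rfl hne

theorem exists_isSign (x : ℝ) : ∃ y : ℤˣ, IsSign x y := by
  by_cases h : 0 ≤ x
  · exact ⟨1, fun _ => rfl, fun h' => absurd h (not_le.2 h')⟩
  · exact ⟨-1, fun h' => absurd h'.le h, fun _ => rfl⟩

variable {M : Matrix (Fin m) (Fin m) ℝ} {N : Matrix (Fin n) (Fin n) ℝ}

/-- The regularised cumulative loss of the first `k` trials. -/
def potential (M : Matrix (Fin m) (Fin m) ℝ) (N : Matrix (Fin n) (Fin n) ℝ)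
    (γ η : ℝ) (S : Trials m n T) (yhat : Fin T → ℤˣ) (k : ℕ)
    (W : Matrix (Fin m ⊕ Fin n) (Fin m ⊕ Fin n) ℝ) : ℝ :=
  regularizer M N W + η * ∑ s ∈ before T k, frob W (lossMat γ S yhat s)

theorem objective_eq_potential (γ η : ℝ) (S : Trials m n T) (yhat : Fin T → ℤˣ) (t : Fin T) :
    objective M N γ η S yhat t = potential M N γ η S yhat (t + 1) := by
  funext W
  rw [objective, potential, regularizer, Iic_eq_before]

theorem potential_succ (γ η : ℝ) (S : Trials m n T) (yhat : Fin T → ℤˣ) (t : Fin T)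
    (W : Matrix (Fin m ⊕ Fin n) (Fin m ⊕ Fin n) ℝ) :
    potential M N γ η S yhat (t + 1) W =
      potential M N γ η S yhat t W + η * frob W (lossMat γ S yhat t) := by
  rw [potential, potential, sum_before_succ]
  ring

theorem exists_isMinOn_potential (γ η : ℝ) (S : Trials m n T) (yhat : Fin T → ℤˣ) (k : ℕ) {D : ℝ}
    (hne : (decisionSet M N D).Nonempty) :
    ∃ W ∈ decisionSet M N D, IsMinOn (potential M N γ η S yhat k) (decisionSet M N D) W := by
  refine (isCompact_decisionSet M N D).exists_isMinOn hne
    ((continuousOn_regularizer M N D).add (Continuous.continuousOn ?_))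
  unfold frob
  fun_prop

/-- Minimisers of two objectives that differ by a multiple of one entry are close there. -/
theorem abs_sub_le_of_isMinOn (hM : M.PosDef) (hN : N.PosDef) {D a : ℝ}
    {W W' : Matrix (Fin m ⊕ Fin n) (Fin m ⊕ Fin n) ℝ} (hW : W ∈ decisionSet M N D)
    (hW' : W' ∈ decisionSet M N D) (i : Fin m) (j : Fin n)
    {F : Matrix (Fin m ⊕ Fin n) (Fin m ⊕ Fin n) ℝ → ℝ}
    (hF : F ((1 / 2 : ℝ) • (W + W')) = (F W + F W') / 2)
    (hmin : ∀ V ∈ decisionSet M N D, regularizer M N W + F W ≤ regularizer M N V + F V)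
    (hmin' : ∀ V ∈ decisionSet M N D,
      regularizer M N W' + F W' + a * W' (Sum.inl i) (Sum.inr j) ≤
        regularizer M N V + F V + a * V (Sum.inl i) (Sum.inr j)) :
    |W (Sum.inl i) (Sum.inr j) - W' (Sum.inl i) (Sum.inr j)| ≤ 8 * |a| := by
  have hmid := midpoint_mem_decisionSet hW hW'
  have h1 := hmin _ hmid
  have h2 := hmin' _ hmid
  have h3 := sq_sub_le_regularizer hM hN hW hW' i j
  simp only [Matrix.smul_apply, Matrix.add_apply, smul_eq_mul] at h2
  set x := W (Sum.inl i) (Sum.inr j)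
  set x' := W' (Sum.inl i) (Sum.inr j)
  -- Both minimality inequalities are tested at the midpoint and added. `F` cancels, leaving a
  -- strong convexity gap of at most a(x - x')/2.
  have h4 : (x - x') ^ 2 ≤ 8 * (a * (x - x')) := by linarith
  have h5 : a * (x - x') ≤ |a| * |x - x'| := by rw [← abs_mul]; exact le_abs_self _
  rw [← sq_abs] at h4
  by_contra! h6
  have := abs_nonneg a
  nlinarith

/-- Linearity of the past losses, in the form that `abs_sub_le_of_isMinOn` asks of `F`. -/
theorem cumulative_midpoint (γ η : ℝ) (S : Trials m n T) (yhat : Fin T → ℤˣ) (k : ℕ)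
    (W W' : Matrix (Fin m ⊕ Fin n) (Fin m ⊕ Fin n) ℝ) :
    η * ∑ s ∈ before T k, frob ((1 / 2 : ℝ) • (W + W')) (lossMat γ S yhat s) =
      (η * ∑ s ∈ before T k, frob W (lossMat γ S yhat s) +
        η * ∑ s ∈ before T k, frob W' (lossMat γ S yhat s)) / 2 := by
  simp only [frob_smul_left, frob_add_left, ← Finset.mul_sum, Finset.sum_add_distrib]
  ring

/-! ### Regret and mistake count of a run. -/

variable {D γ η : ℝ} {S : Trials m n T}
  {W : Fin (T + 1) → Matrix (Fin m ⊕ Fin n) (Fin m ⊕ Fin n) ℝ} {yhat : Fin T → ℤˣ}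

theorem IsRun.mem_decisionSet (h : IsRun M N D γ η S W yhat) (k : Fin (T + 1)) :
    W k ∈ decisionSet M N D := by
  induction k using Fin.induction with
  | zero => exact h.init
  | succ t ih =>
    by_cases ht : yhat t = (S t).2
    · rwa [h.keep t ht]
    · exact (h.update t ht).1

/-- Be-the-leader inequality. -/
theorem IsRun.be_the_leader (h : IsRun M N D γ η S W yhat) (k : Fin (T + 1)) :
    ∀ V ∈ decisionSet M N D,
      η * ∑ s ∈ before T k, frob (W s.succ) (lossMat γ S yhat s) - D ≤
        potential M N γ η S yhat k V := by
  induction k using Fin.induction with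
  | zero =>
    intro V hV
    -- The arbitrary initial matrix need not minimise the regulariser, so the induction starts from
    -- its lower bound -D.
    simpa [potential, before_zero] using neg_le_regularizer hV
  | succ t ih =>
    intro V hV
    simp only [Fin.val_castSucc] at ih
    rw [Fin.val_succ, sum_before_succ, mul_add]
    by_cases ht : yhat t = (S t).2
    · have := ih V hV
      simpa [potential_succ, lossMat_of_eq ht, frob_zero_right] using this
    · obtain ⟨h1, h2⟩ := h.update t ht
      have h3 : objective M N γ η S yhat t (W t.succ) ≤ objective M N γ η S yhat t V := h2 hV
      rw [objective_eq_potential, potential_succ] at h3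
      -- The induction hypothesis is used at the new leader itself, whose minimality then passes the
      -- bound to `V`.
      have := ih _ h1
      linarith

/-- The loss of the updated matrices is small: each mistake but the first costs at most `1 / 2`. -/
theorem IsRun.neg_le_sum_frob (h : IsRun M N D γ η S W yhat) (hM : M.PosDef) (hN : N.PosDef)
    (hγ : 0 < γ) (hη : 0 ≤ η) (hηγ : 16 * η ≤ γ ^ 2) (k : Fin (T + 1)) :
    (∀ s ∈ before T k, yhat s = (S s).2) ∨
      (IsMinOn (potential M N γ η S yhat k) (decisionSet M N D) (W k) ∧
        -((((before T k).filter fun s => yhat s ≠ (S s).2).card : ℝ) / 2) - 1 / γ ≤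
          ∑ s ∈ before T k, frob (W s.succ) (lossMat γ S yhat s)) := by
  induction k using Fin.induction with
  | zero => left; simp [before_zero]
  | succ t ih =>
    simp only [Fin.val_castSucc] at ih
    rw [Fin.val_succ, sum_before_succ]
    by_cases ht : yhat t = (S t).2
    · rcases ih with h0 | ⟨h1, h2⟩
      · left
        intro s hs
        rw [before_succ, Finset.mem_insert] at hs
        rcases hs with rfl | hs
        exacts [ht, h0 s hs]
      · right
        have e : potential M N γ η S yhat (t + 1) = potential M N γ η S yhat t := by
          funext V
          rw [potential_succ, lossMat_of_eq ht, frob_zero_right, mul_zero, add_zero]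
        rw [e, h.keep t ht, lossMat_of_eq ht, frob_zero_right, add_zero, before_succ,
          Finset.filter_insert, if_neg (not_not.2 ht)]
        exact ⟨h1, h2⟩
    · right
      obtain ⟨hmem, hmin⟩ := h.update t ht
      have hmem' := h.mem_decisionSet t.castSucc
      rw [← objective_eq_potential]
      refine ⟨hmin, ?_⟩
      have hcard : (((before T (t + 1)).filter fun s => yhat s ≠ (S s).2).card : ℝ) =
          ((before T t).filter fun s => yhat s ≠ (S s).2).card + 1 := by
        rw [before_succ, Finset.filter_insert, if_pos ht, Finset.card_insert_of_notMem]
        · push_cast; rfl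
        · simp [notMem_before]
      rw [hcard, frob_lossMat_of_ne ht hmem.1.1]
      set y := lab (S t).2 with hy
      have hyabs : |y| = 1 := abs_lab _
      have hpred := lab_mul_nonpos_of_isSign_of_ne (h.predict t) ht
      rw [frob_Zmat hmem'.1.1, ← hy] at hpred
      rcases ih with h0 | ⟨h1, h2⟩
      -- First mistake: the current matrix is still the arbitrary initial one, so stability is
      -- unavailable and only the entry bound 1 applies, at cost 1/γ.
      · have e1 : ∑ s ∈ before T t, frob (W s.succ) (lossMat γ S yhat s) = 0 :=
          Finset.sum_eq_zero fun s hs => by rw [lossMat_of_eq (h0 s hs), frob_zero_right]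
        have e2 : ((before T t).filter fun s => yhat s ≠ (S s).2).card = 0 := by
          simpa [Finset.filter_eq_empty_iff] using h0
        rw [e1, e2]
        have h3 := abs_apply_le_one hmem.1 hmem.2.1 (Sum.inl (S t).1.1) (Sum.inr (S t).1.2)
        have h4 : y * W t.succ (Sum.inl (S t).1.1) (Sum.inr (S t).1.2) ≤ 1 := by
          refine (le_abs_self _).trans ?_
          rw [abs_mul, hyabs, one_mul]; exact h3
        have h5 := div_le_div_of_nonneg_right h4 hγ.le
        have h6 : -y / γ * W t.succ (Sum.inl (S t).1.1) (Sum.inr (S t).1.2) =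
          -(y * W t.succ (Sum.inl (S t).1.1) (Sum.inr (S t).1.2) / γ) := by ring
        rw [h6]
        push_cast
        linarith
      -- Later mistakes: both matrices are minimisers, and their objectives differ by η(-y/γ) times
      -- one entry.
      · have hst := abs_sub_le_of_isMinOn hM hN hmem' hmem (S t).1.1 (S t).1.2
          (a := η * (-y / γ))
          (F := fun V => η * ∑ s ∈ before T t, frob V (lossMat γ S yhat s))
          (cumulative_midpoint γ η S yhat t _ _) (fun V hV => h1 hV)
          (fun V hV => by
            have h3 : objective M N γ η S yhat t (W t.succ) ≤ objective M N γ η S yhat t V :=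
              hmin hV
            rw [objective_eq_potential, potential_succ, potential_succ,
              frob_lossMat_of_ne ht hmem.1.1, frob_lossMat_of_ne ht hV.1.1, potential,
              potential] at h3
            linarith)
        set x := W t.castSucc (Sum.inl (S t).1.1) (Sum.inr (S t).1.2)
        set x' := W t.succ (Sum.inl (S t).1.1) (Sum.inr (S t).1.2)
        rw [abs_mul, abs_div, abs_neg, hyabs, abs_of_nonneg hη, abs_of_pos hγ] at hst
        have h7 : y * (x' - x) ≤ 8 * (η * (1 / γ)) := by
          refine (le_abs_self _).trans ?_
          rw [abs_mul, hyabs, one_mul, abs_sub_comm]; exact hst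
        -- Since y x ≤ 0 on a mistake, y x' ≤ 8η/γ, and 16η ≤ γ² makes this at most γ/2.
        have h8 : y * x' / γ ≤ 1 / 2 := by
          rw [div_le_iff₀ hγ]
          have h9 : 8 * (η * (1 / γ)) ≤ 1 / 2 * γ := by
            rw [mul_one_div, ← mul_div_assoc, div_le_iff₀ hγ]
            nlinarith
          linarith
        have h10 : -y / γ * x' = -(y * x' / γ) := by ring
        rw [h10]
        linarith

/-- The mistake bound against a fixed element of the decision set. -/
theorem IsRun.mistakes_le (h : IsRun M N D γ η S W yhat) (hM : M.PosDef) (hN : N.PosDef)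
    (hγ : 0 < γ) (hη : 0 < η) (hηγ : 16 * η ≤ γ ^ 2) (hD : 0 ≤ D)
    {V : Matrix (Fin m ⊕ Fin n) (Fin m ⊕ Fin n) ℝ} (hV : V ∈ decisionSet M N D) :
    (mistakes S yhat : ℝ) ≤ 2 * (D / η) + 2 / γ +
      2 * ∑ t, hinge γ (lab (S t).2 * V (Sum.inl (S t).1.1) (Sum.inr (S t).1.2)) := by
  have hh : 0 ≤ ∑ t, hinge γ (lab (S t).2 * V (Sum.inl (S t).1.1) (Sum.inr (S t).1.2)) :=
    Finset.sum_nonneg fun _ _ => hinge_nonneg hγ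
  have h1 := h.neg_le_sum_frob hM hN hγ hη.le hηγ (Fin.last T)
  have h2 := h.be_the_leader (Fin.last T) V hV
  rw [potential] at h2
  rw [Fin.val_last, before_self] at h1 h2
  rcases h1 with h0 | ⟨-, h1⟩
  · have : mistakes S yhat = 0 := by
      simpa [mistakes, Finset.filter_eq_empty_iff] using h0
    rw [this]
    have : 0 ≤ 2 * (D / η) + 2 / γ := by positivity
    push_cast
    linarith
  · change -((mistakes S yhat : ℝ) / 2) - 1 / γ ≤ _ at h1
    -- On a mistake the loss of `V` is at most its hinge loss minus 1; on the other trials it is 0,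
    -- and the hinge loss is nonnegative.
    have h3 : ∑ t, frob V (lossMat γ S yhat t) ≤
        ∑ t, hinge γ (lab (S t).2 * V (Sum.inl (S t).1.1) (Sum.inr (S t).1.2)) -
          mistakes S yhat := by
      have e : (mistakes S yhat : ℝ) = ∑ t, if yhat t ≠ (S t).2 then (1 : ℝ) else 0 := by
        rw [mistakes, Finset.card_filter]
        push_cast
        rfl
      rw [e, ← Finset.sum_sub_distrib]
      refine Finset.sum_le_sum fun t _ => ?_
      split_ifs with ht
      · rw [frob_lossMat_of_ne ht hV.1.1]
        have := one_sub_div_le_hinge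
          (x := lab (S t).2 * V (Sum.inl (S t).1.1) (Sum.inr (S t).1.2)) hγ
        have e2 : -lab (S t).2 / γ * V (Sum.inl (S t).1.1) (Sum.inr (S t).1.2) =
          -(lab (S t).2 * V (Sum.inl (S t).1.1) (Sum.inr (S t).1.2) / γ) := by ring
        linarith
      · rw [lossMat_of_eq (not_not.1 ht), frob_zero_right, sub_zero]
        exact hinge_nonneg hγ
    have h4 := regularizer_nonpos hV
    have h5 := (mul_le_mul_of_nonneg_left h1 hη.le)
    have h6 := (mul_le_mul_of_nonneg_left h3 hη.le)
    set v := ∑ t, hinge γ (lab (S t).2 * V (Sum.inl (S t).1.1) (Sum.inr (S t).1.2))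
    -- The competitor's credit of 1 per mistake exceeds the leaders' 1/2; the surviving half
    -- produces the factor 2 in the bound.
    have h7 : η * ((mistakes S yhat : ℝ) / 2 - 1 / γ - v) ≤ D := by linarith
    rw [← le_div_iff₀' hη] at h7
    have e : 2 / γ = 2 * (1 / γ) := by ring
    linarith

/-- For a margin of at least `2` the hinge loss is at least half the number of trials. -/
theorem mistakes_le_two_mul_sum_hinge (hγ : 2 ≤ γ)
    {V : Matrix (Fin m ⊕ Fin n) (Fin m ⊕ Fin n) ℝ} (hV : V ∈ decisionSet M N D) :
    (mistakes S yhat : ℝ) ≤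
      2 * ∑ t, hinge γ (lab (S t).2 * V (Sum.inl (S t).1.1) (Sum.inr (S t).1.2)) := by
  have h1 : mistakes S yhat ≤ T := (Finset.card_le_univ _).trans_eq (Fintype.card_fin T)
  have h2 : (T : ℝ) * (1 / 2) ≤
      ∑ t, hinge γ (lab (S t).2 * V (Sum.inl (S t).1.1) (Sum.inr (S t).1.2)) := by
    have : (T : ℝ) * (1 / 2) = ∑ _t : Fin T, (1 / 2 : ℝ) := by simp
    rw [this]
    refine Finset.sum_le_sum fun t _ => le_trans ?_ (one_sub_div_le_hinge (by linarith))
    have h3 : lab (S t).2 * V (Sum.inl (S t).1.1) (Sum.inr (S t).1.2) ≤ 1 := by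
      refine (le_abs_self _).trans ?_
      rw [abs_mul, abs_lab, one_mul]
      exact abs_apply_le_one hV.1 hV.2.1 _ _
    have h4 : lab (S t).2 * V (Sum.inl (S t).1.1) (Sum.inr (S t).1.2) / γ ≤ 1 / 2 := by
      rw [div_le_iff₀ (by linarith)]; linarith
    linarith
  have : (mistakes S yhat : ℝ) ≤ T := by exact_mod_cast h1
  linarith

/-! ### Nonemptiness of the competitor class and existence of runs. -/

theorem nonempty_hloss_values (hM : M.PosDef) (hN : N.PosDef) {U : Matrix (Fin m) (Fin n) ℝ}
    (S : Trials m n T) (hne : (quasiDimValues M N γ U).Nonempty) (hD : quasiDim M N γ U ≤ D) :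
    {v | ∃ (d : ℕ) (P : Matrix (Fin m) (Fin d) ℝ) (Q : Matrix (Fin n) (Fin d) ℝ),
      NonzeroRows P ∧ NonzeroRows Q ∧ normalizeRows P * (normalizeRows Q)ᵀ ∈ competitors M N D ∧
        v = hlossPair S P Q γ}.Nonempty := by
  obtain ⟨P, Q, hP, hQ, -, hc⟩ := exists_sideComplexity_le hM hN hne hD
  have hP0 := nonzeroRows_of_rowNormalized hP
  have hQ0 := nonzeroRows_of_rowNormalized hQ
  exact ⟨_, m + n, P, Q, hP0, hQ0, ⟨m + n, P, Q, hP0, hQ0,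
    by rwa [normalizeRows_eq_self hP, normalizeRows_eq_self hQ], rfl⟩, rfl⟩

/-- Compactness and continuity give each minimiser. Predictions not yet made hold the placeholder 1;
this is harmless because the objective after trial `t` reads only trials up to `t`, where the state
agrees with the final predictions. -/
theorem exists_isRun (S : Trials m n T) {W₁ : Matrix (Fin m ⊕ Fin n) (Fin m ⊕ Fin n) ℝ}
    (hW₁ : W₁ ∈ decisionSet M N D) :
    ∃ W yhat, IsRun M N D γ η S W yhat ∧ W 0 = W₁ := by
  choose sgn hsgn using exists_isSign
  choose upd hupd using fun (yhat : Fin T → ℤˣ) (k : ℕ) =>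
    exists_isMinOn_potential (M := M) (N := N) γ η S yhat k ⟨W₁, hW₁⟩
  -- the state: the current matrix, and the predictions made so far
  let next : (t : Fin T) → Matrix (Fin m ⊕ Fin n) (Fin m ⊕ Fin n) ℝ × (Fin T → ℤˣ) →
      Matrix (Fin m ⊕ Fin n) (Fin m ⊕ Fin n) ℝ × (Fin T → ℤˣ) := fun t st =>
    let y := Function.update st.2 t (sgn (frob st.1 (Zmat (S t).1)))
    (if y t = (S t).2 then st.1 else upd y (t + 1), y)
  let st : Fin (T + 1) → Matrix (Fin m ⊕ Fin n) (Fin m ⊕ Fin n) ℝ × (Fin T → ℤˣ) :=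
    fun k => Fin.induction (motive := fun _ => _) (W₁, fun _ => 1) next k
  have hsucc : ∀ t : Fin T, st t.succ = next t (st t.castSucc) := fun t =>
    Fin.induction_succ (motive := fun _ => _) _ _ t
  let yhat : Fin T → ℤˣ := fun t => (st t.succ).2 t
  have hyhat : ∀ t, yhat t = sgn (frob (st t.castSucc).1 (Zmat (S t).1)) := fun t => by
    simp [yhat, hsucc, next]
  have hagree : ∀ k : Fin (T + 1), ∀ s ∈ before T k, (st k).2 s = yhat s := by
    intro k
    induction k using Fin.induction with
    | zero => simp [before_zero]
    | succ t ih =>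
      intro s hs
      rw [Fin.val_succ, before_succ, Finset.mem_insert] at hs
      rcases hs with rfl | hs
      · rfl
      · rw [hsucc, ← ih s hs]
        exact Function.update_of_ne (by rintro rfl; exact notMem_before _ hs) _ _
  have hpot : ∀ t : Fin T, potential M N γ η S (st t.succ).2 (t + 1) =
      objective M N γ η S yhat t := by
    intro t
    rw [objective_eq_potential]
    funext V
    rw [potential, potential]
    congr 2
    refine Finset.sum_congr rfl fun s hs => ?_
    rw [lossMat, lossMat, hagree t.succ s (by rwa [Fin.val_succ])]
  have hval : ∀ t : Fin T, (st t.succ).1 = if yhat t = (S t).2 then (st t.castSucc).1 else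
      upd (st t.succ).2 (t + 1) := fun t => by
    have : ∀ p, p = next t (st t.castSucc) → p.1 = if p.2 t = (S t).2 then (st t.castSucc).1 else
        upd p.2 (t + 1) := by
      rintro _ rfl
      rfl
    exact this _ (hsucc t)
  refine ⟨fun k => (st k).1, yhat, ⟨hW₁, fun t => ?_, fun t ht => ?_, fun t ht => ?_⟩, rfl⟩
  · rw [hyhat]; exact hsgn _
  · simp only [hval t, if_pos ht]
  · simp only [hval t, if_neg ht]
    rw [← hpot]
    exact hupd _ _

end Trials

end OMC

end

/-! ### Choice of constants and conclusion. -/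

theorem mainTheorem2 :
    ∃ c₀ : ℝ, 0 < c₀ ∧ ∀ c : ℝ, 0 < c → c ≤ c₀ → ∃ C : ℝ, 0 < C ∧
      ∀ (m n T : ℕ) (M : Matrix (Fin m) (Fin m) ℝ) (N : Matrix (Fin n) (Fin n) ℝ)
        (U : Matrix (Fin m) (Fin n) ℝ) (γ D : ℝ) (S : OMC.Trials m n T),
        M.PosDef → N.PosDef → 0 < γ → 1 ≤ D →
        (OMC.quasiDimValues M N γ U).Nonempty → OMC.quasiDim M N γ U ≤ D →
        (∀ W₁ ∈ OMC.decisionSet M N D, ∃ W yhat,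
          OMC.IsRun M N D γ (c * γ ^ 2) S W yhat ∧ W 0 = W₁) ∧
        ∀ W yhat, OMC.IsRun M N D γ (c * γ ^ 2) S W yhat →
          (OMC.mistakes S yhat : ℝ) ≤ C * (D / γ ^ 2) + 2 * OMC.hloss M N D S γ := by
  -- c₀ = 1/16 is the condition 16η ≤ γ². In C, the term 2/c comes from 2D/η and 4 absorbs 2/γ.
  refine ⟨1 / 16, by norm_num, fun c hc hc₀ => ⟨2 / c + 4, by positivity, ?_⟩⟩
  intro m n T M N U γ D S hM hN hγ hD hne hqd
  refine ⟨fun W₁ hW₁ => OMC.exists_isRun S hW₁, fun W yhat h => ?_⟩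
  have hpos : 0 ≤ (2 / c + 4) * (D / γ ^ 2) := by positivity
  suffices hsuff : ((OMC.mistakes S yhat : ℝ) - (2 / c + 4) * (D / γ ^ 2)) / 2 ≤
      OMC.hloss M N D S γ by linarith
  refine le_csInf (OMC.nonempty_hloss_values hM hN S hne hqd) ?_
  rintro v ⟨d, P, Q, -, -, hX, rfl⟩
  obtain ⟨V, hV, hv⟩ := OMC.exists_decisionSet_hlossPair_eq (S := S) (γ := γ) hM hN hX
  rw [hv]
  -- For γ ≤ 2, D ≥ 1 gives 2/γ ≤ 4D/γ². For γ ≥ 2 every trial costs any competitor at least 1/2, so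
  -- twice the hinge loss already exceeds or equals T.
  rcases le_total 2 γ with h2 | h2
  · have := OMC.mistakes_le_two_mul_sum_hinge (S := S) (yhat := yhat) h2 hV
    linarith
  · have h1 := h.mistakes_le hM hN hγ (by positivity) (by nlinarith [sq_nonneg γ]) (by linarith) hV
    have h3 : 2 * (D / (c * γ ^ 2)) + 2 / γ ≤ (2 / c + 4) * (D / γ ^ 2) := by
      have e1 : 2 * (D / (c * γ ^ 2)) = 2 / c * (D / γ ^ 2) := by field_simp
      have e2 : 2 / γ ≤ 4 * (D / γ ^ 2) := by
        rw [← mul_div_assoc, div_le_div_iff₀ hγ (by positivity)]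
        nlinarith
      rw [e1, add_mul]
      linarith
    linarith
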